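/- Let $\mathbf{G}$ be a compact connected (Hausdorff) Lie group with Lie algebra $\mathfrak{g}$, let $X_1,\dots,X_m\in\mathfrak g$ generate $\mathfrak g$ as a Lie algebra, and regard each $X_k$ as a right-invariant vector field $U\mapsto X_kU$ on $\mathbf{G}$. Let $\mathbf{V}\subset\mathbb{R}^m$ be compact with $0\in\mathbf{V}$, and consider the control system $$\dot U=f(U,v(t)),\qquad f(U,v)=\sum_{k=1}^m v_k X_k U,\qquad U(0)=U_0\in\mathbf{G},$$ whose controls $v:[0,\infty)\to\mathbf{V}$ are piecewise continuous (one-sided limits everywhere, and finitely many discontinuities in each bounded interval); denote its solution by $U(t;v,U_0)$. Let $\mathbf{T}\subset\mathbf{G}$ be a compact target set with topological boundary $\partial\mathbf{T}$, and let $t_{U_0}(v)\in[0,\infty]$ be the first time $t\ge 0$ with $U(t;v,U_0)\in\partial\mathbf{T}$ ($+\infty$ if there is none). Let $\ell:\mathbf{G}\times\mathbf{V}\to\mathbb{R}$, let $\lambda\ge 0$, and define the value function, with values in $[-\infty,+\infty]$, by $$S(U_0)=\inf_{v}\int_0^{t_{U_0}(v)}\ell\big(U(s;v,U_0),v(s)\big)\,e^{-\lambda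 s}\,ds .$$ If $\lambda=0$, assume in addition that $\partial\mathbf{T}\neq\emptyset$ and that $\ell\ge c$ on $\mathbf{G}\times\mathbf{V}$ for some constant $c>0$. Suppose that 1. $f:\mathbf{G}\times\mathbf{V}\to T\mathbf{G}$ is continuous; 2. $\ell:\mathbf{G}\times\mathbf{V}\to\mathbb{R}$ is continuous; 3. $S$ is continuous on some open set containing $\partial\mathbf{T}$. Then $S$ is finite, bounded and continuous on all of $\mathbf{G}$. -/

import Mathlib

open Set Filter Topology
open scoped Manifold ContDiff

/-- Smooth real Lie groups have the finite smoothness that Mathlib asks for in order to equip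
the tangent space at the identity with its Lie algebra structure. -/
instance instLEInftyMinSmoothness : ENat.LEInfty (minSmoothness ℝ 3) :=
  ⟨by rw [minSmoothness_of_isRCLikeNormedField]; exact ENat.LEInfty.out⟩

noncomputable section

namespace LieControl

/-- The right-invariant vector field on `G` with value `ξ` at the identity: at `g` it is the image
of `ξ` under the differential of right multiplication by `g` (for a matrix group, `ξ g`). -/
def rightInvariantField {d : ℕ} {G : Type*} [TopologicalSpace G]
    [ChartedSpace (EuclideanSpace ℝ (Fin d)) G] [Group G]
    (ξ : GroupLieAlgebra (𝓡 d) G) (g : G) : TangentSpace (𝓡 d) g :=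
  mfderiv (𝓡 d) (𝓡 d) (fun h : G => h * g) (1 : G) ξ

/-- The driftless dynamics `f(U, v) = ∑ k, v k • X k (U)`, with `X k` the right-invariant
vector field of the `k`-th Lie algebra element. -/
def dynamics {d m : ℕ} {G : Type*} [TopologicalSpace G]
    [ChartedSpace (EuclideanSpace ℝ (Fin d)) G] [Group G]
    (X : Fin m → GroupLieAlgebra (𝓡 d) G) (g : G) (v : Fin m → ℝ) : TangentSpace (𝓡 d) g :=
  ∑ k, v k • rightInvariantField (X k) g

/-- Control signals: functions on `[0, ∞)` with values in `V` that are piecewise continuous, i.e.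
have one-sided limits everywhere and only finitely many discontinuities in each bounded interval.
(The values at negative times are irrelevant.) -/
structure IsControl {m : ℕ} (V : Set (Fin m → ℝ)) (v : ℝ → Fin m → ℝ) : Prop where
  mem : ∀ t, 0 ≤ t → v t ∈ V
  finite_discontinuities :
    ∀ R : ℝ, {t | t ∈ Icc 0 R ∧ ¬ ContinuousWithinAt v (Ici 0) t}.Finite
  right_limit : ∀ t, 0 ≤ t → ∃ a, Tendsto v (𝓝[>] t) (𝓝 a)
  left_limit : ∀ t, 0 < t → ∃ a, Tendsto v (𝓝[<] t) (𝓝 a)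

/-- `U` solves `dU/dt = f(U, v)`, `U(0) = U₀` on `[0, ∞)`: it is continuous, starts at `U₀`, and
satisfies the differential equation except at finitely many times in each bounded interval.
For a control `v` this determines `U` on `[0, ∞)`. -/
structure IsTrajectory {d m : ℕ} {G : Type*} [TopologicalSpace G]
    [ChartedSpace (EuclideanSpace ℝ (Fin d)) G] [Group G]
    (X : Fin m → GroupLieAlgebra (𝓡 d) G) (v : ℝ → Fin m → ℝ) (U₀ : G) (U : ℝ → G) : Prop where
  initial : U 0 = U₀
  continuousOn : ContinuousOn U (Ici 0)
  ode : ∃ D : Set ℝ, (∀ R : ℝ, (D ∩ Icc 0 R).Finite) ∧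
    ∀ t, 0 < t → t ∉ D →
      HasMFDerivAt 𝓘(ℝ, ℝ) (𝓡 d) U t
        ((1 : ℝ →L[ℝ] ℝ).smulRight (dynamics X (U t) (v t)))

/-- The nonnegative times at which `U` is in the set `C`. -/
def hitTimes {G : Type*} (C : Set G) (U : ℝ → G) : Set ℝ := {t | 0 ≤ t ∧ U t ∈ C}

open Classical in
/-- The discounted cost `∫₀^τ ℓ(U(s), v(s)) e^{-λ s} ds`, where `τ` is the first time at which `U`
reaches `C`. If `C` is never reached then `τ = ∞` and the integral is the improper one,
an extended real number. -/
def cost {m : ℕ} {G : Type*} (C : Set G) (ℓ : G → (Fin m → ℝ) → ℝ) (lam : ℝ)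
    (v : ℝ → Fin m → ℝ) (U : ℝ → G) : EReal :=
  if (hitTimes C U).Nonempty then
    ((∫ s in (0 : ℝ)..sInf (hitTimes C U), ℓ (U s) (v s) * Real.exp (-lam * s) : ℝ) : EReal)
  else
    limsup (fun R : ℝ =>
      ((∫ s in (0 : ℝ)..R, ℓ (U s) (v s) * Real.exp (-lam * s) : ℝ) : EReal)) atTop

/-- The value function for the target set `T`: the infimum over all controls of the cost up to the
time at which the boundary of `T` is reached. As the trajectory is determined by the control and
the initial point, the infimum is taken over pairs of a control and its trajectory. -/
def valueFunction {d m : ℕ} {G : Type*} [TopologicalSpace G]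
    [ChartedSpace (EuclideanSpace ℝ (Fin d)) G] [Group G]
    (X : Fin m → GroupLieAlgebra (𝓡 d) G) (V : Set (Fin m → ℝ)) (T : Set G)
    (ℓ : G → (Fin m → ℝ) → ℝ) (lam : ℝ) (U₀ : G) : EReal :=
  sInf {c | ∃ v U, IsControl V v ∧ IsTrajectory X v U₀ U ∧ c = cost (frontier T) ℓ lam v U}

end LieControl

end

/-! The vector fields are right-invariant, so one control steers `g` along `U` and `g * h` along `U
* h`. The two trajectories stay uniformly close for all time when `h` is near `1`, with no
exponential growth of the gap. By uniform continuity of `ℓ` their running costs then differ by at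
most `η * K`, where `K` bounds the discounted time `∫ exp (-lam * s)` spent before hitting `frontier
T`. Stop at the first time when either trajectory meets `frontier T`: both points are then near the
boundary, where `S` is continuous and vanishes. Dynamic programming on both sides gives `S (g * h) ≤
S g + 4 * ε` for all `g` at once (`valueFunction_mul_right_le`), and hence continuity
(`continuous_of_valueFunction_eq`).

The bound `K` comes from discounting if `lam > 0`. If `lam = 0`, it comes from `ℓ ≥ c > 0` once `S`
is bounded above (`valueFunction_zero_bddAbove`). For that, every point must be steered into a
neighbourhood of the boundary where `S < 1`. The points that can be so steered form an open set; it
is also closed, because in a compact group the closure of the reachable semigroup contains inverses.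
Connectedness finishes (`exists_mul_mem_of_isOpen`). -/

namespace LieControl

/-! ### Shifting and concatenating controls. -/

/-- Follow `a` up to time `t₀` and then restart with `b`. -/
noncomputable def concat {α : Type*} (t₀ : ℝ) (a b : ℝ → α) (t : ℝ) : α :=
  if t < t₀ then a t else b (t - t₀)

theorem concat_of_lt {α : Type*} {t₀ t : ℝ} (a b : ℝ → α) (h : t < t₀) :
    concat t₀ a b t = a t := if_pos h

theorem concat_of_ge {α : Type*} {t₀ t : ℝ} (a b : ℝ → α) (h : t₀ ≤ t) :
    concat t₀ a b t = b (t - t₀) := if_neg h.not_gt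

theorem concat_of_le {α : Type*} {t₀ t : ℝ} {a b : ℝ → α} (hab : b 0 = a t₀) (h : t ≤ t₀) :
    concat t₀ a b t = a t := by
  rcases h.lt_or_eq with h | rfl
  · exact concat_of_lt a b h
  · rw [concat_of_ge a b le_rfl, sub_self, hab]

theorem concat_eventuallyEq_left {α : Type*} {t₀ t : ℝ} (a b : ℝ → α) (h : t < t₀) :
    concat t₀ a b =ᶠ[𝓝 t] a := by
  filter_upwards [Iio_mem_nhds h] with s hs using concat_of_lt a b hs

theorem concat_eventuallyEq_right {α : Type*} {t₀ t : ℝ} (a b : ℝ → α) (h : t₀ < t) :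
    concat t₀ a b =ᶠ[𝓝 t] fun s => b (s - t₀) := by
  filter_upwards [Ioi_mem_nhds h] with s hs using concat_of_ge a b (le_of_lt hs)

theorem tendsto_sub_nhdsGT (t t₀ : ℝ) : Tendsto (fun s => s - t₀) (𝓝[>] t) (𝓝[>] (t - t₀)) :=
  tendsto_nhdsWithin_iff.2 ⟨((continuous_id.sub continuous_const).tendsto t).mono_left
    nhdsWithin_le_nhds, eventually_nhdsWithin_of_forall fun _ hs => sub_lt_sub_right hs t₀⟩

theorem tendsto_sub_nhdsLT (t t₀ : ℝ) : Tendsto (fun s => s - t₀) (𝓝[<] t) (𝓝[<] (t - t₀)) :=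
  tendsto_nhdsWithin_iff.2 ⟨((continuous_id.sub continuous_const).tendsto t).mono_left
    nhdsWithin_le_nhds, eventually_nhdsWithin_of_forall fun _ hs => sub_lt_sub_right hs t₀⟩

section Control

variable {m : ℕ} {V : Set (Fin m → ℝ)} {v w : ℝ → Fin m → ℝ}

theorem isControl_const {u : Fin m → ℝ} (hu : u ∈ V) : IsControl V fun _ => u where
  mem _ _ := hu
  finite_discontinuities R := by simp [continuousWithinAt_const]
  right_limit _ _ := ⟨u, tendsto_const_nhds⟩
  left_limit _ _ := ⟨u, tendsto_const_nhds⟩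

theorem IsControl.shift (hv : IsControl V v) {t₀ : ℝ} (h₀ : 0 ≤ t₀) :
    IsControl V fun t => v (t + t₀) where
  mem t ht := hv.mem _ (add_nonneg ht h₀)
  finite_discontinuities R := by
    refine ((hv.finite_discontinuities (R + t₀)).preimage
      ((add_left_injective t₀).injOn (s := univ) |>.mono (subset_univ _))).subset ?_
    rintro t ⟨ht, hd⟩
    refine ⟨⟨add_nonneg ht.1 h₀, by linarith [ht.2]⟩, fun hc => hd ?_⟩
    exact ContinuousWithinAt.comp (g := v) (f := fun t => t + t₀) (t := Ici 0) hc
      (by fun_prop) fun s hs => add_nonneg hs h₀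
  right_limit t ht := by
    obtain ⟨a, ha⟩ := hv.right_limit (t + t₀) (add_nonneg ht h₀)
    exact ⟨a, ha.comp (by simpa using tendsto_sub_nhdsGT t (-t₀))⟩
  left_limit t ht := by
    obtain ⟨a, ha⟩ := hv.left_limit (t + t₀) (by linarith)
    exact ⟨a, ha.comp (by simpa using tendsto_sub_nhdsLT t (-t₀))⟩

theorem IsControl.concat (hv : IsControl V v) (hw : IsControl V w) (t₀ : ℝ) :
    IsControl V (concat t₀ v w) where
  mem t ht := by
    rcases lt_or_ge t t₀ with h | h
    · rw [concat_of_lt v w h]; exact hv.mem t ht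
    · rw [concat_of_ge v w h]; exact hw.mem _ (sub_nonneg.2 h)
  finite_discontinuities R := by
    refine (((hv.finite_discontinuities R).union ((hw.finite_discontinuities (R - t₀)).preimage
      ((sub_left_injective (b := t₀)).injOn (s := univ) |>.mono (subset_univ _)))).union
        (finite_singleton t₀)).subset ?_
    rintro t ⟨ht, hd⟩
    rcases lt_trichotomy t t₀ with h | h | h
    · refine Or.inl (Or.inl ⟨ht, fun hc => hd ?_⟩)
      exact hc.congr_of_eventuallyEq ((concat_eventuallyEq_left v w h).filter_mono
        nhdsWithin_le_nhds) (concat_of_lt v w h)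
    · exact Or.inr h
    · refine Or.inl (Or.inr ⟨⟨by linarith, by linarith [ht.2]⟩, fun hc => hd ?_⟩)
      have hc' : ContinuousAt w (t - t₀) := hc.continuousAt (Ici_mem_nhds (by linarith))
      have : ContinuousAt (fun s => w (s - t₀)) t :=
        ContinuousAt.comp (g := w) (f := fun s => s - t₀) hc' (by fun_prop)
      exact (this.congr (concat_eventuallyEq_right v w h).symm).continuousWithinAt
  right_limit t ht := by
    rcases lt_or_ge t t₀ with h | h
    · obtain ⟨a, ha⟩ := hv.right_limit t ht
      exact ⟨a, ha.congr' ((concat_eventuallyEq_left v w h).symm.filter_mono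
        nhdsWithin_le_nhds)⟩
    · obtain ⟨a, ha⟩ := hw.right_limit (t - t₀) (sub_nonneg.2 h)
      refine ⟨a, (ha.comp (tendsto_sub_nhdsGT t t₀)).congr' ?_⟩
      filter_upwards [self_mem_nhdsWithin] with s hs
      exact (concat_of_ge v w (h.trans (le_of_lt hs))).symm
  left_limit t ht := by
    rcases le_or_gt t t₀ with h | h
    · obtain ⟨a, ha⟩ := hv.left_limit t ht
      refine ⟨a, ha.congr' ?_⟩
      filter_upwards [self_mem_nhdsWithin] with s hs
      exact (concat_of_lt v w (lt_of_lt_of_le hs h)).symm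
    · obtain ⟨a, ha⟩ := hw.left_limit (t - t₀) (by linarith)
      exact ⟨a, (ha.comp (tendsto_sub_nhdsLT t t₀)).congr'
        ((concat_eventuallyEq_right v w h).symm.filter_mono nhdsWithin_le_nhds)⟩

end Control

/-! ### Trajectories: time shift, concatenation, right translation. -/

theorem hasMFDerivAt_comp_add {d : ℕ} {G : Type*} [TopologicalSpace G]
    [ChartedSpace (EuclideanSpace ℝ (Fin d)) G] {U : ℝ → G} {t t₀ : ℝ} {x : EuclideanSpace ℝ (Fin d)}
    (h : HasMFDerivAt 𝓘(ℝ, ℝ) (𝓡 d) U (t + t₀)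
      ((1 : ℝ →L[ℝ] ℝ).smulRight (x : TangentSpace (𝓡 d) (U (t + t₀))))) :
    HasMFDerivAt 𝓘(ℝ, ℝ) (𝓡 d) (fun s => U (s + t₀)) t
      ((1 : ℝ →L[ℝ] ℝ).smulRight (x : TangentSpace (𝓡 d) (U (t + t₀)))) := by
  have h1 : HasMFDerivAt 𝓘(ℝ, ℝ) 𝓘(ℝ, ℝ) (fun s : ℝ => s + t₀) t (ContinuousLinearMap.id ℝ ℝ) :=
    ((hasFDerivAt_id t).add_const t₀).hasMFDerivAt
  exact (HasMFDerivAt.comp t h h1).congr_mfderiv rfl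

section Trajectory

variable {d m : ℕ} {G : Type*} [TopologicalSpace G] [ChartedSpace (EuclideanSpace ℝ (Fin d)) G]
  [Group G] {X : Fin m → GroupLieAlgebra (𝓡 d) G} {v w : ℝ → Fin m → ℝ} {g : G} {U W : ℝ → G}

theorem isTrajectory_const (X : Fin m → GroupLieAlgebra (𝓡 d) G) (g : G) :
    IsTrajectory X (fun _ => 0) g fun _ => g where
  initial := rfl
  continuousOn := continuousOn_const
  ode := by
    refine ⟨∅, by simp, fun t _ _ => ?_⟩
    have h0 : dynamics X g 0 = 0 := by simp [dynamics]
    have := hasMFDerivAt_const (I := 𝓘(ℝ, ℝ)) (I' := 𝓡 d) g t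
    refine this.congr_mfderiv ?_
    ext1
    simp only [h0, ContinuousLinearMap.smulRight_zero]
    rfl

theorem IsTrajectory.shift (hU : IsTrajectory X v g U) {t₀ : ℝ} (h₀ : 0 ≤ t₀) :
    IsTrajectory X (fun t => v (t + t₀)) (U t₀) fun t => U (t + t₀) where
  initial := by simp
  continuousOn := hU.continuousOn.comp (by fun_prop) fun t ht => add_nonneg ht h₀
  ode := by
    obtain ⟨D, hD, hode⟩ := hU.ode
    refine ⟨(· + t₀) ⁻¹' D, fun R => ?_, fun t ht htD =>
      hasMFDerivAt_comp_add (hode (t + t₀) (by linarith) htD)⟩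
    refine ((hD (R + t₀)).preimage
      ((add_left_injective t₀).injOn (s := univ) |>.mono (subset_univ _))).subset ?_
    rintro t ⟨h, ht⟩
    exact ⟨h, add_nonneg ht.1 h₀, by linarith [ht.2]⟩

theorem IsTrajectory.concat {t₀ : ℝ} (h₀ : 0 ≤ t₀) (hU : IsTrajectory X v g U)
    (hW : IsTrajectory X w (U t₀) W) :
    IsTrajectory X (concat t₀ v w) g (concat t₀ U W) where
  initial := by rw [concat_of_le hW.initial h₀, hU.initial]
  continuousOn := by
    rw [← Icc_union_Ici_eq_Ici h₀]
    refine ContinuousOn.union_of_isClosed ?_ ?_ isClosed_Icc isClosed_Ici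
    · exact (hU.continuousOn.mono Icc_subset_Ici_self).congr
        fun t ht => concat_of_le hW.initial ht.2
    · have : ContinuousOn (fun t => W (t - t₀)) (Ici t₀) :=
        hW.continuousOn.comp (by fun_prop) fun t ht => mem_Ici.2 (sub_nonneg.2 ht)
      exact this.congr fun t ht => concat_of_ge U W ht
  ode := by
    obtain ⟨D, hD, hodeU⟩ := hU.ode
    obtain ⟨E, hE, hodeW⟩ := hW.ode
    -- `E` is locally finite only on nonnegative times, hence the cut by `Ici 0` before translating.
    refine ⟨D ∪ (· - t₀) ⁻¹' (E ∩ Ici 0) ∪ {t₀}, fun R => ?_, fun t ht htD => ?_⟩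
    · refine (((hD R).union ((hE (R - t₀)).preimage
        ((sub_left_injective (b := t₀)).injOn (s := univ) |>.mono (subset_univ _)))).union
          (finite_singleton t₀)).subset ?_
      rintro t ⟨(h | h) | h, ht⟩
      · exact Or.inl (Or.inl ⟨h, ht⟩)
      · exact Or.inl (Or.inr ⟨h.1, h.2, by linarith [ht.2]⟩)
      · exact Or.inr h
    · rcases lt_trichotomy t t₀ with h | h | h
      · have := hodeU t ht fun hd => htD (Or.inl (Or.inl hd))
        have h2 := this.congr_of_eventuallyEq (concat_eventuallyEq_left U W h)
        rw [concat_of_lt v w h]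
        refine h2.congr_mfderiv ?_
        rw [concat_of_lt U W h]
      · exact absurd (Or.inr h) htD
      · have := hodeW (t - t₀) (by linarith) fun hd =>
          htD (Or.inl (Or.inr ⟨hd, sub_nonneg.2 h.le⟩))
        rw [sub_eq_add_neg] at this
        have h2 := (hasMFDerivAt_comp_add this).congr_of_eventuallyEq
          (concat_eventuallyEq_right U W h)
        rw [concat_of_ge v w h.le]
        refine h2.congr_mfderiv ?_
        rw [concat_of_ge U W h.le]
        rfl

variable [LieGroup (𝓡 d) ∞ G]

/-- Chain rule for the composition of the right translations by `g` and by `h`, which is right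
translation by `g * h`. -/
theorem mfderiv_mul_right_rightInvariantField (ξ : GroupLieAlgebra (𝓡 d) G) (g h : G) :
    mfderiv (𝓡 d) (𝓡 d) (fun x : G => x * h) g (rightInvariantField ξ g) =
      rightInvariantField ξ (g * h) := by
  have hd (a b : G) : MDifferentiableAt (𝓡 d) (𝓡 d) (fun x : G => x * a) b :=
    (contMDiff_mul_right (I := 𝓡 d) (n := ∞) (a := a)).mdifferentiable (by simp) b
  have := mfderiv_comp_apply_of_eq (x := (1 : G)) (y := g) (hd h g) (hd g 1) (one_mul g) ξ
  have e : (fun x : G => x * h) ∘ (fun x : G => x * g) = fun x : G => x * (g * h) := by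
    ext x; simp [mul_assoc]
  rw [e] at this
  exact this.symm

theorem mfderiv_mul_right_dynamics (X : Fin m → GroupLieAlgebra (𝓡 d) G) (g h : G)
    (u : Fin m → ℝ) :
    mfderiv (𝓡 d) (𝓡 d) (fun x : G => x * h) g (dynamics X g u) = dynamics X (g * h) u := by
  unfold dynamics
  rw [map_sum]
  refine Finset.sum_congr rfl fun k _ => ?_
  rw [map_smul, mfderiv_mul_right_rightInvariantField]

/-- The symmetry behind the whole proof: it compares trajectories from different initial points
under the same control. -/
theorem IsTrajectory.mul_right [ContinuousMul G] (hU : IsTrajectory X v g U) (h : G) :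
    IsTrajectory X v (g * h) fun t => U t * h where
  initial := by rw [hU.initial]
  continuousOn := hU.continuousOn.mul continuousOn_const
  ode := by
    obtain ⟨D, hD, hode⟩ := hU.ode
    refine ⟨D, hD, fun t ht htD => ?_⟩
    have hd : MDifferentiableAt (𝓡 d) (𝓡 d) (fun x : G => x * h) (U t) :=
      (contMDiff_mul_right (I := 𝓡 d) (n := ∞) (a := h)).mdifferentiable (by simp) _
    refine (HasMFDerivAt.comp t hd.hasMFDerivAt (hode t ht htD)).congr_mfderiv ?_
    ext1
    exact (congrArg _ (one_smul ℝ _)).trans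
      ((mfderiv_mul_right_dynamics X (U t) h (v t)).trans (one_smul ℝ _).symm)

end Trajectory

/-! ### The cost of a trajectory and its splitting at an intermediate time. -/

theorem integrableOn_Icc_of_finite_of_bound {f : ℝ → ℝ} {a b M : ℝ} {F : Set ℝ} (hF : F.Finite)
    (hf : ContinuousOn f (Icc a b \ F)) (hM : ∀ t ∈ Icc a b, |f t| ≤ M) :
    MeasureTheory.IntegrableOn f (Icc a b) := by
  have hms : MeasurableSet (Icc a b \ F) := measurableSet_Icc.diff hF.measurableSet
  have h1 : MeasureTheory.IntegrableOn f (Icc a b \ F) := by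
    have : MeasureTheory.IsFiniteMeasure (MeasureTheory.volume.restrict (Icc a b \ F)) :=
      ⟨by
        rw [MeasureTheory.Measure.restrict_apply_univ]
        exact (MeasureTheory.measure_mono sdiff_subset).trans_lt measure_Icc_lt_top⟩
    exact MeasureTheory.Integrable.of_bound (hf.aestronglyMeasurable hms) M
      ((MeasureTheory.ae_restrict_iff' hms).2 (Eventually.of_forall fun t ht => hM t ht.1))
  exact h1.congr_set_ae (MeasureTheory.sdiff_null_ae_eq_self (hF.measure_zero _)).symm

/-- For finite `a` and finite `b > 0` the map `x ↦ a + b * x` is monotone and continuous on `EReal`,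
so it commutes with `limsup`, infinite values included. -/
theorem limsup_coe_affine {f : ℝ → ℝ} (a : ℝ) {b : ℝ} (hb : 0 < b) :
    limsup (fun R : ℝ => ((a + b * f R : ℝ) : EReal)) atTop =
      a + b * limsup (fun R : ℝ => ((f R : ℝ) : EReal)) atTop := by
  have hmono : Monotone fun x : EReal => (a : EReal) + b * x := fun x y hxy => by
    have : (0 : EReal) ≤ b := by exact_mod_cast hb.le
    dsimp only
    gcongr
  have hcont : Continuous fun x : EReal => (a : EReal) + b * x := by
    refine continuous_iff_continuousAt.2 fun x => ?_
    have hb0 : (b : EReal) ≠ 0 := by exact_mod_cast hb.ne'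
    have h1 : ContinuousAt (fun x : EReal => (b : EReal) * x) x :=
      ContinuousAt.comp (g := fun p : EReal × EReal => p.1 * p.2) (f := fun x => ((b : EReal), x))
        (EReal.continuousAt_mul (Or.inl hb0) (Or.inl hb0) (Or.inl (EReal.coe_ne_bot b))
          (Or.inl (EReal.coe_ne_top b))) (by fun_prop)
    exact ContinuousAt.comp (g := fun p : EReal × EReal => p.1 + p.2)
      (f := fun x => ((a : EReal), (b : EReal) * x))
      (EReal.continuousAt_add (Or.inl (EReal.coe_ne_top a)) (Or.inl (EReal.coe_ne_bot a)))
      (continuousAt_const.prodMk h1)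
  have := hmono.map_limsup_of_continuousAt (F := atTop) (fun R : ℝ => ((f R : ℝ) : EReal))
    hcont.continuousAt
  rw [this]
  refine congrArg (fun u => limsup u atTop) (funext fun R => ?_)
  simp

/-- The discounted cost accumulated up to time `t`. -/
noncomputable def runningCost {m : ℕ} {G : Type*} (ℓ : G → (Fin m → ℝ) → ℝ) (lam : ℝ)
    (v : ℝ → Fin m → ℝ) (U : ℝ → G) (t : ℝ) : ℝ :=
  ∫ s in (0 : ℝ)..t, ℓ (U s) (v s) * Real.exp (-lam * s)

section Cost

variable {m : ℕ} {G : Type*} {C : Set G} {ℓ : G → (Fin m → ℝ) → ℝ} {lam : ℝ}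
  {v w : ℝ → Fin m → ℝ} {U W : ℝ → G}

theorem runningCost_congr {t : ℝ} (ht : 0 ≤ t) (hv : EqOn v w (Ioo 0 t)) (hU : EqOn U W (Ioo 0 t)) :
    runningCost ℓ lam v U t = runningCost ℓ lam w W t :=
  intervalIntegral.integral_congr_Ioo_of_le ht fun s hs => by
    simp only [hv hs, hU hs]

theorem cost_of_isLeast {τ : ℝ} (h : IsLeast (hitTimes C U) τ) :
    cost C ℓ lam v U = (runningCost ℓ lam v U τ : ℝ) := by
  rw [cost, if_pos ⟨τ, h.1⟩, h.csInf_eq, runningCost]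

theorem cost_of_not_nonempty (h : ¬ (hitTimes C U).Nonempty) :
    cost C ℓ lam v U = limsup (fun R : ℝ => ((runningCost ℓ lam v U R : ℝ) : EReal)) atTop := by
  rw [cost, if_neg h]; rfl

theorem cost_congr (hv : EqOn v w (Ici 0)) (hU : EqOn U W (Ici 0)) :
    cost C ℓ lam v U = cost C ℓ lam w W := by
  have hhit : hitTimes C U = hitTimes C W := by
    ext t
    exact and_congr_right fun ht => by rw [hU ht]
  have hrun {t : ℝ} (ht : 0 ≤ t) : runningCost ℓ lam v U t = runningCost ℓ lam w W t :=
    runningCost_congr ht (hv.mono fun s hs => hs.1.le) (hU.mono fun s hs => hs.1.le)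
  by_cases h : (hitTimes C W).Nonempty
  · rw [cost, cost, if_pos h, hhit, if_pos h]
    exact congrArg _ (hrun (Real.sInf_nonneg fun t ht => ht.1))
  · rw [cost_of_not_nonempty h, cost_of_not_nonempty (hhit ▸ h)]
    refine limsup_congr ?_
    filter_upwards [eventually_ge_atTop (0 : ℝ)] with R hR
    rw [hrun hR]

theorem runningCost_add {t s : ℝ}
    (h1 : IntervalIntegrable (fun s => ℓ (U s) (v s) * Real.exp (-lam * s)) MeasureTheory.volume 0 t)
    (h2 : IntervalIntegrable (fun s => ℓ (U s) (v s) * Real.exp (-lam * s)) MeasureTheory.volume t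
      (s + t)) :
    runningCost ℓ lam v U (s + t) = runningCost ℓ lam v U t +
      Real.exp (-lam * t) * runningCost ℓ lam (fun r => v (r + t)) (fun r => U (r + t)) s := by
  have h3 := intervalIntegral.integral_add_adjacent_intervals h1 h2
  rw [runningCost, ← h3, runningCost, runningCost]
  congr 1
  rw [← intervalIntegral.integral_const_mul]
  have := intervalIntegral.integral_comp_add_right
    (fun s => ℓ (U s) (v s) * Real.exp (-lam * s)) t (a := 0) (b := s)
  rw [zero_add] at this
  rw [← this]
  refine intervalIntegral.integral_congr fun r _ => ?_
  rw [mul_left_comm, ← Real.exp_add]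
  ring_nf

/-- The first hitting time of the shifted trajectory is the old one minus `t`. Avoidance of `C` is
required only strictly before `t`, so `t` may itself be the hitting time. -/
theorem cost_eq_runningCost_add_cost
    (hint : ∀ a b : ℝ, 0 ≤ a → 0 ≤ b →
      IntervalIntegrable (fun s => ℓ (U s) (v s) * Real.exp (-lam * s)) MeasureTheory.volume a b)
    (hmin : (hitTimes C U).Nonempty → ∃ τ, IsLeast (hitTimes C U) τ)
    {t : ℝ} (ht : 0 ≤ t) (hno : ∀ s, 0 ≤ s → s < t → U s ∉ C) :
    cost C ℓ lam v U = (runningCost ℓ lam v U t : ℝ) + ((Real.exp (-lam * t) : ℝ) : EReal) *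
      cost C ℓ lam (fun s => v (s + t)) (fun s => U (s + t)) := by
  have hadd {s : ℝ} (hs : 0 ≤ s) := runningCost_add (hint 0 t le_rfl ht)
    (hint t (s + t) ht (add_nonneg hs ht))
  by_cases h : (hitTimes C U).Nonempty
  · obtain ⟨τ, hτ⟩ := hmin h
    have hle : t ≤ τ := not_lt.1 fun hlt => hno τ hτ.1.1 hlt hτ.1.2
    have hτ' : IsLeast (hitTimes C fun s => U (s + t)) (τ - t) := by
      refine ⟨⟨sub_nonneg.2 hle, by simpa using hτ.1.2⟩, fun s hs => ?_⟩
      have := hτ.2 ⟨add_nonneg hs.1 ht, hs.2⟩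
      linarith
    rw [cost_of_isLeast hτ, cost_of_isLeast hτ', ← EReal.coe_mul, ← EReal.coe_add,
      ← hadd (sub_nonneg.2 hle), sub_add_cancel]
  · have h' : ¬ (hitTimes C fun s => U (s + t)).Nonempty := fun ⟨s, hs⟩ =>
      h ⟨s + t, add_nonneg hs.1 ht, hs.2⟩
    rw [cost_of_not_nonempty h, cost_of_not_nonempty h', ← limsup_coe_affine _ (Real.exp_pos _)]
    conv_lhs => rw [← map_add_atTop_eq t, ← limsup_comp]
    refine limsup_congr ?_
    filter_upwards [eventually_ge_atTop (0 : ℝ)] with R hR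
    rw [Function.comp_apply, hadd hR]

end Cost

theorem exists_isLeast_hitTimes {G : Type*} [TopologicalSpace G] {C : Set G} (hC : IsClosed C)
    {U : ℝ → G} (hU : ContinuousOn U (Ici 0)) (h : (hitTimes C U).Nonempty) :
    ∃ τ, IsLeast (hitTimes C U) τ := by
  have hcl : IsClosed (hitTimes C U) := hU.preimage_isClosed_of_isClosed isClosed_Ici hC
  exact ⟨_, hcl.isLeast_csInf h ⟨0, fun t ht => ht.1⟩⟩

theorem exists_abs_le_of_isCompact {m : ℕ} {G : Type*} [TopologicalSpace G] [CompactSpace G]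
    {V : Set (Fin m → ℝ)} (hV : IsCompact V) {ℓ : G → (Fin m → ℝ) → ℝ}
    (hℓ : ContinuousOn (fun p : G × (Fin m → ℝ) => ℓ p.1 p.2) (univ ×ˢ V)) :
    ∃ M : ℝ, 0 ≤ M ∧ ∀ g, ∀ u ∈ V, |ℓ g u| ≤ M := by
  obtain ⟨M, hM⟩ := (isCompact_univ.prod hV).exists_bound_of_continuousOn hℓ
  exact ⟨max M 0, le_max_right _ _, fun g u hu => (hM (g, u) ⟨mem_univ _, hu⟩).trans (le_max_left _ _)⟩

theorem intervalIntegrable_runningCost {m : ℕ} {G : Type*} [TopologicalSpace G] [CompactSpace G]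
    {V : Set (Fin m → ℝ)} (hV : IsCompact V) {ℓ : G → (Fin m → ℝ) → ℝ}
    (hℓ : ContinuousOn (fun p : G × (Fin m → ℝ) => ℓ p.1 p.2) (univ ×ˢ V)) (lam : ℝ)
    {v : ℝ → Fin m → ℝ} (hv : IsControl V v) {U : ℝ → G} (hU : ContinuousOn U (Ici 0))
    (a b : ℝ) (ha : 0 ≤ a) (hb : 0 ≤ b) :
    IntervalIntegrable (fun s => ℓ (U s) (v s) * Real.exp (-lam * s)) MeasureTheory.volume a b := by
  obtain ⟨M, hM0, hM⟩ := exists_abs_le_of_isCompact hV hℓ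
  have key : MeasureTheory.IntegrableOn (fun s => ℓ (U s) (v s)) (Icc 0 (max a b)) := by
    refine integrableOn_Icc_of_finite_of_bound (hv.finite_discontinuities (max a b)) ?_
      fun t ht => hM _ _ (hv.mem t ht.1)
    refine hℓ.comp (f := fun s => (U s, v s)) ((hU.mono fun t ht => ht.1.1).prodMk ?_)
      fun t ht => ⟨mem_univ _, hv.mem t ht.1.1⟩
    intro t ht
    have : ContinuousWithinAt v (Ici 0) t := by
      by_contra hc
      exact ht.2 ⟨ht.1, hc⟩
    exact this.mono fun s hs => hs.1.1
  have h2 : IntervalIntegrable (fun s => ℓ (U s) (v s)) MeasureTheory.volume a b := by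
    rw [intervalIntegrable_iff]
    refine key.mono_set ?_
    rw [uIoc]
    exact fun t ht => ⟨(le_min ha hb).trans ht.1.le, ht.2⟩
  exact h2.mul_continuousOn (by fun_prop)

/-! ### The two dynamic programming inequalities. -/

section ValueFunction

variable {d m : ℕ} {G : Type*} [TopologicalSpace G] [ChartedSpace (EuclideanSpace ℝ (Fin d)) G]
  [Group G] {X : Fin m → GroupLieAlgebra (𝓡 d) G} {V : Set (Fin m → ℝ)}
  {T : Set G} {ℓ : G → (Fin m → ℝ) → ℝ} {lam : ℝ} {v w : ℝ → Fin m → ℝ} {g : G} {U W : ℝ → G}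

theorem valueFunction_le (hv : IsControl V v) (hU : IsTrajectory X v g U) :
    valueFunction X V T ℓ lam g ≤ cost (frontier T) ℓ lam v U :=
  sInf_le ⟨v, U, hv, hU, rfl⟩

theorem exists_cost_lt {x : EReal} (h : valueFunction X V T ℓ lam g < x) :
    ∃ v U, IsControl V v ∧ IsTrajectory X v g U ∧ cost (frontier T) ℓ lam v U < x := by
  obtain ⟨_, ⟨v, U, hv, hU, rfl⟩, hlt⟩ := sInf_lt_iff.1 h
  exact ⟨v, U, hv, hU, hlt⟩

variable [CompactSpace G]

theorem runningCost_add_valueFunction_le_cost (hV : IsCompact V)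
    (hℓ : ContinuousOn (fun p : G × (Fin m → ℝ) => ℓ p.1 p.2) (univ ×ˢ V))
    (hv : IsControl V v) (hU : IsTrajectory X v g U) {t : ℝ} (ht : 0 ≤ t)
    (hno : ∀ s, 0 ≤ s → s < t → U s ∉ frontier T) :
    (runningCost ℓ lam v U t : ℝ) + ((Real.exp (-lam * t) : ℝ) : EReal) *
      valueFunction X V T ℓ lam (U t) ≤ cost (frontier T) ℓ lam v U := by
  rw [cost_eq_runningCost_add_cost (intervalIntegrable_runningCost hV hℓ lam hv hU.continuousOn)
    (exists_isLeast_hitTimes isClosed_frontier hU.continuousOn) ht hno]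
  have : (0 : EReal) ≤ (Real.exp (-lam * t) : ℝ) := by exact_mod_cast (Real.exp_pos _).le
  gcongr
  exact valueFunction_le (hv.shift ht) (hU.shift ht)

/-- The continuation `W` is left arbitrary, so that near-optimal ones can be inserted later without
moving an infimum through `EReal` arithmetic. -/
theorem valueFunction_le_runningCost_add_cost (hV : IsCompact V)
    (hℓ : ContinuousOn (fun p : G × (Fin m → ℝ) => ℓ p.1 p.2) (univ ×ˢ V))
    (hv : IsControl V v) (hU : IsTrajectory X v g U) {t : ℝ} (ht : 0 ≤ t)
    (hno : ∀ s, 0 ≤ s → s < t → U s ∉ frontier T)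
    (hw : IsControl V w) (hW : IsTrajectory X w (U t) W) :
    valueFunction X V T ℓ lam g ≤ (runningCost ℓ lam v U t : ℝ) +
      ((Real.exp (-lam * t) : ℝ) : EReal) * cost (frontier T) ℓ lam w W := by
  have hv' := hv.concat hw t
  have hU' := hU.concat ht hW
  refine (valueFunction_le hv' hU').trans_eq ?_
  rw [cost_eq_runningCost_add_cost (intervalIntegrable_runningCost hV hℓ lam hv' hU'.continuousOn)
    (exists_isLeast_hitTimes isClosed_frontier hU'.continuousOn) ht
      fun s hs hst => by rw [concat_of_lt U W hst]; exact hno s hs hst]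
  congr 2
  · exact runningCost_congr ht (fun s hs => concat_of_lt v w hs.2)
      fun s hs => concat_of_lt U W hs.2
  · refine cost_congr (fun s hs => ?_) fun s hs => ?_
    · rw [concat_of_ge _ _ (le_add_of_nonneg_left hs), add_sub_cancel_right]
    · rw [concat_of_ge _ _ (le_add_of_nonneg_left hs), add_sub_cancel_right]

end ValueFunction

/-! ### Semigroups in compact connected groups. -/

/-- In a compact group `s⁻¹` is a cluster point of the powers `s ^ n` with `n → ∞`. -/
theorem inv_mem_topologicalClosure {G : Type*} [Group G] [TopologicalSpace G]
    [IsTopologicalGroup G] [CompactSpace G] (M : Submonoid G) {s : G}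
    (hs : s ∈ M.topologicalClosure) : s⁻¹ ∈ M.topologicalClosure := by
  have h := ((mapClusterPt_atTop_pow_tfae (s ^ (-1 : ℤ)) s).out 0 2).1
    (mapClusterPt_self_zpow_atTop_pow s (-1))
  rw [zpow_neg_one] at h
  exact closure_minimal (range_subset_iff.2 fun n => pow_mem hs n)
    M.isClosed_topologicalClosure h

/-- The set `R` of points that `M` can move into `O` is open, and it equals the compact product of
the closure of `M` with `C`. Being clopen and nonempty, it is all of `G`. -/
theorem exists_mul_mem_of_isOpen {G : Type*} [Group G] [TopologicalSpace G]
    [IsTopologicalGroup G] [CompactSpace G] [ConnectedSpace G] [T2Space G] (M : Submonoid G)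
    {O C : Set G} (hO : IsOpen O) (hC : IsClosed C) (hne : C.Nonempty) (hCO : C ⊆ O)
    (h : ∀ g ∈ O, ∃ s ∈ M, s * g ∈ C) (g : G) : ∃ s ∈ M, s * g ∈ O := by
  let R : Set G := {g | ∃ s ∈ M, s * g ∈ O}
  have hRo : IsOpen R := by
    have : R = ⋃ s ∈ M, (fun g => s * g) ⁻¹' O := by
      ext x; simp [R]
    rw [this]
    exact isOpen_biUnion fun s _ => hO.preimage (by fun_prop)
  have hRc : IsClosed R := by
    have hR : R = (fun p : G × G => p.1 * p.2) '' ((M.topologicalClosure : Set G) ×ˢ C) := by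
      ext x
      constructor
      · rintro ⟨s, hs, hx⟩
        obtain ⟨r, hr, hrx⟩ := h _ hx
        refine ⟨((r * s)⁻¹, r * (s * x)), ⟨?_, hrx⟩, by group⟩
        exact inv_mem_topologicalClosure M
          (M.le_topologicalClosure (M.mul_mem hr hs))
      · rintro ⟨⟨k, c⟩, ⟨hk, hc⟩, rfl⟩
        -- `k⁻¹` sends `k * c` to `c ∈ O`; since `O` is open, so does some element of `M` close to
        -- `k⁻¹`.
        have hk' : k⁻¹ ∈ closure (M : Set G) := inv_mem_topologicalClosure M hk
        have ho : IsOpen ((fun y => y * (k * c)) ⁻¹' O) := hO.preimage (by fun_prop)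
        obtain ⟨s, hs, hsM⟩ := mem_closure_iff.1 hk' _ ho (by simpa using hCO hc)
        exact ⟨s, hsM, hs⟩
    rw [hR]
    exact ((M.isClosed_topologicalClosure.isCompact.prod hC.isCompact).image
      continuous_mul).isClosed
  have hu : R = univ := IsClopen.eq_univ ⟨hRc, hRo⟩ <| by
    obtain ⟨c, hc⟩ := hne
    exact ⟨c, 1, M.one_mem, by simpa using hCO hc⟩
  exact (hu ▸ mem_univ g : g ∈ R)

/-! ### Estimates for running costs and uniform continuity of `ℓ`. -/

section Estimates

theorem integral_exp_neg_mul_le {lam : ℝ} (hlam : 0 < lam) (t : ℝ) :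
    ∫ s in (0 : ℝ)..t, Real.exp (-lam * s) ≤ 1 / lam := by
  have hd (s : ℝ) : HasDerivAt (fun s => -(1 / lam) * Real.exp (-lam * s)) (Real.exp (-lam * s)) s := by
    have h1 : HasDerivAt (fun s => -lam * s) (-lam) s := by
      simpa using (hasDerivAt_id s).const_mul (-lam)
    refine (h1.exp.const_mul (-(1 / lam))).congr_deriv ?_
    field_simp
  rw [intervalIntegral.integral_eq_sub_of_hasDerivAt (fun s _ => hd s)
    ((by fun_prop : Continuous fun s : ℝ => Real.exp (-lam * s)).intervalIntegrable _ _)]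
  have h1 : 0 < 1 / lam := by positivity
  have h2 := Real.exp_pos (-lam * t)
  simp only [mul_zero, Real.exp_zero]
  nlinarith

variable {m : ℕ} {G : Type*} {ℓ : G → (Fin m → ℝ) → ℝ} {lam : ℝ}
  {v : ℝ → Fin m → ℝ} {U W : ℝ → G}

theorem abs_integral_mul_exp_le {f : ℝ → ℝ} {M t : ℝ} (ht : 0 ≤ t)
    (hM : ∀ s, 0 ≤ s → |f s| ≤ M) :
    |∫ s in (0 : ℝ)..t, f s * Real.exp (-lam * s)| ≤
      M * ∫ s in (0 : ℝ)..t, Real.exp (-lam * s) := by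
  have hi : IntervalIntegrable (fun s => M * Real.exp (-lam * s)) MeasureTheory.volume 0 t :=
    Continuous.intervalIntegrable (by fun_prop) 0 t
  rw [← intervalIntegral.integral_const_mul]
  refine intervalIntegral.norm_integral_le_of_norm_le (E := ℝ) ht (.of_forall fun s hs => ?_) hi
  rw [norm_mul, Real.norm_eq_abs, Real.norm_eq_abs, Real.abs_exp]
  exact mul_le_mul_of_nonneg_right (hM s hs.1.le) (Real.exp_pos _).le

theorem abs_runningCost_le {M t : ℝ} (ht : 0 ≤ t) (hM : ∀ s, 0 ≤ s → |ℓ (U s) (v s)| ≤ M) :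
    |runningCost ℓ lam v U t| ≤ M * ∫ s in (0 : ℝ)..t, Real.exp (-lam * s) :=
  abs_integral_mul_exp_le ht hM

theorem abs_runningCost_sub_le {η t : ℝ} (ht : 0 ≤ t)
    (hU : IntervalIntegrable (fun s => ℓ (U s) (v s) * Real.exp (-lam * s))
      MeasureTheory.volume 0 t)
    (hW : IntervalIntegrable (fun s => ℓ (W s) (v s) * Real.exp (-lam * s))
      MeasureTheory.volume 0 t)
    (hη : ∀ s, 0 ≤ s → |ℓ (W s) (v s) - ℓ (U s) (v s)| ≤ η) :
    |runningCost ℓ lam v W t - runningCost ℓ lam v U t| ≤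
      η * ∫ s in (0 : ℝ)..t, Real.exp (-lam * s) := by
  rw [runningCost, runningCost, ← intervalIntegral.integral_sub hW hU]
  simpa only [sub_mul] using abs_integral_mul_exp_le (lam := lam) ht hη

theorem mul_le_runningCost_zero {c t : ℝ} (ht : 0 ≤ t)
    (hU : IntervalIntegrable (fun s => ℓ (U s) (v s) * Real.exp (-0 * s))
      MeasureTheory.volume 0 t)
    (hc : ∀ s, 0 ≤ s → c ≤ ℓ (U s) (v s)) : c * t ≤ runningCost ℓ 0 v U t := by
  have h := intervalIntegral.integral_mono_on (f := fun _ => c) ht (by simp) hU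
    fun s hs => by simpa using hc s hs.1
  simpa [runningCost, mul_comm] using h

theorem cost_zero_eq_top {C : Set G} {c : ℝ} (hc0 : 0 < c)
    (hU : ∀ a b : ℝ, 0 ≤ a → 0 ≤ b → IntervalIntegrable
      (fun s => ℓ (U s) (v s) * Real.exp (-0 * s)) MeasureTheory.volume a b)
    (hc : ∀ s, 0 ≤ s → c ≤ ℓ (U s) (v s)) (h : ¬ (hitTimes C U).Nonempty) :
    cost C ℓ 0 v U = ⊤ := by
  rw [cost_of_not_nonempty h]
  refine Tendsto.limsup_eq (EReal.tendsto_coe_atTop.comp ?_)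
  refine tendsto_atTop_mono' _ ?_ (tendsto_id.const_mul_atTop hc0)
  filter_upwards [eventually_ge_atTop (0 : ℝ)] with R hR
  exact mul_le_runningCost_zero hR (hU 0 R le_rfl hR) hc

end Estimates

section Continuity

variable {m : ℕ} {G : Type*} [TopologicalSpace G] [Group G] [ContinuousMul G] [CompactSpace G]

/-- The difference vanishes at `h = 1`; compactness of `G × V` makes the neighbourhood of `1`
uniform. -/
theorem eventually_abs_mul_right_sub_le {V : Set (Fin m → ℝ)} (hV : IsCompact V)
    {ℓ : G → (Fin m → ℝ) → ℝ}
    (hℓ : ContinuousOn (fun p : G × (Fin m → ℝ) => ℓ p.1 p.2) (univ ×ˢ V)) {η : ℝ} (hη : 0 < η) :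
    ∀ᶠ h in 𝓝 (1 : G), ∀ g, ∀ u ∈ V, |ℓ (g * h) u - ℓ g u| ≤ η := by
  have : CompactSpace V := isCompact_iff_compactSpace.1 hV
  have hc : Continuous fun p : G × V => ℓ p.1 p.2 :=
    hℓ.comp_continuous (f := fun p : G × V => (p.1, (p.2 : Fin m → ℝ))) (by fun_prop)
      fun p => ⟨mem_univ _, p.2.2⟩
  have hF : Continuous fun p : G × (G × V) => |ℓ (p.2.1 * p.1) p.2.2 - ℓ p.2.1 p.2.2| := by
    have h1 : Continuous fun p : G × (G × V) => ℓ (p.2.1 * p.1) p.2.2 :=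
      hc.comp (g := fun p : G × V => ℓ p.1 p.2) (f := fun p : G × (G × V) => (p.2.1 * p.1, p.2.2))
        (by fun_prop)
    exact (h1.sub (hc.comp continuous_snd)).abs
  have := isCompact_univ.eventually_forall_of_forall_eventually (x₀ := (1 : G))
    (K := (univ : Set (G × V)))
    (P := fun h p => |ℓ (p.1 * h) p.2 - ℓ p.1 p.2| < η) fun p _ =>
      hF.continuousAt.eventually_lt continuousAt_const (by simpa using hη)
  filter_upwards [this] with h hh g u hu
  exact (hh (g, ⟨u, hu⟩) (mem_univ _)).le

end Continuity

/-! ### Bounds and continuity for the value function. -/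

section ValueFunction

variable {d m : ℕ} {G : Type*} [TopologicalSpace G] [ChartedSpace (EuclideanSpace ℝ (Fin d)) G]
  [Group G] {X : Fin m → GroupLieAlgebra (𝓡 d) G} {V : Set (Fin m → ℝ)}
  {T : Set G} {ℓ : G → (Fin m → ℝ) → ℝ} {lam : ℝ}

theorem valueFunction_eq_zero (hV0 : (0 : Fin m → ℝ) ∈ V) {g : G} (hg : g ∈ frontier T) :
    valueFunction X V T ℓ lam g = 0 := by
  have key {v : ℝ → Fin m → ℝ} {U : ℝ → G} (hU : U 0 = g) : cost (frontier T) ℓ lam v U = 0 := by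
    have : IsLeast (hitTimes (frontier T) U) 0 := ⟨⟨le_rfl, hU ▸ hg⟩, fun t ht => ht.1⟩
    rw [cost_of_isLeast this, runningCost, intervalIntegral.integral_same, EReal.coe_zero]
  refine le_antisymm ?_ (le_sInf ?_)
  · exact (valueFunction_le (isControl_const hV0) (isTrajectory_const X g)).trans_eq (key rfl)
  · rintro _ ⟨v, U, -, hU, rfl⟩
    exact (key hU.initial).ge

theorem exists_real_valueFunction {B : ℝ}
    (h : ∀ g, ((-B : ℝ) : EReal) ≤ valueFunction X V T ℓ lam g ∧
      valueFunction X V T ℓ lam g ≤ (B : ℝ)) :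
    ∃ S : G → ℝ, (∀ g, valueFunction X V T ℓ lam g = (S g : EReal)) ∧ ∀ g, |S g| ≤ B := by
  have hS (g : G) : valueFunction X V T ℓ lam g =
      ((valueFunction X V T ℓ lam g).toReal : EReal) :=
    (EReal.coe_toReal ((h g).2.trans_lt (EReal.coe_lt_top B)).ne
      ((EReal.bot_lt_coe (-B)).trans_le (h g).1).ne').symm
  refine ⟨_, hS, fun g => abs_le.2 ?_⟩
  have := h g
  rw [hS] at this
  exact ⟨EReal.coe_le_coe_iff.1 this.1, EReal.coe_le_coe_iff.1 this.2⟩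

variable [CompactSpace G]

theorem abs_valueFunction_le_of_pos (hV : IsCompact V) (hV0 : (0 : Fin m → ℝ) ∈ V)
    (hℓ : ContinuousOn (fun p : G × (Fin m → ℝ) => ℓ p.1 p.2) (univ ×ˢ V)) (hlam : 0 < lam) :
    ∃ B : ℝ, ∀ g, ((-B : ℝ) : EReal) ≤ valueFunction X V T ℓ lam g ∧
      valueFunction X V T ℓ lam g ≤ (B : ℝ) := by
  obtain ⟨M, hM0, hM⟩ := exists_abs_le_of_isCompact hV hℓ
  have hJ {v : ℝ → Fin m → ℝ} (U : ℝ → G) (hv : IsControl V v) {t : ℝ} (ht : 0 ≤ t) :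
      |runningCost ℓ lam v U t| ≤ M * (1 / lam) :=
    (abs_runningCost_le ht fun s hs => hM _ _ (hv.mem s hs)).trans
      (mul_le_mul_of_nonneg_left (integral_exp_neg_mul_le hlam t) hM0)
  have hcost {v : ℝ → Fin m → ℝ} {U : ℝ → G} (hv : IsControl V v) (hU : ContinuousOn U (Ici 0)) :
      ((-(M * (1 / lam)) : ℝ) : EReal) ≤ cost (frontier T) ℓ lam v U ∧
        cost (frontier T) ℓ lam v U ≤ (M * (1 / lam) : ℝ) := by
    by_cases h : (hitTimes (frontier T) U).Nonempty
    · obtain ⟨τ, hτ⟩ := exists_isLeast_hitTimes isClosed_frontier hU h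
      rw [cost_of_isLeast hτ]
      have := abs_le.1 (hJ U hv hτ.1.1)
      exact ⟨EReal.coe_le_coe_iff.2 this.1, EReal.coe_le_coe_iff.2 this.2⟩
    · rw [cost_of_not_nonempty h]
      have hev : ∀ᶠ R in atTop, |runningCost ℓ lam v U R| ≤ M * (1 / lam) := by
        filter_upwards [eventually_ge_atTop (0 : ℝ)] with R hR using hJ U hv hR
      refine ⟨le_limsup_of_frequently_le (Eventually.frequently ?_), limsup_le_of_le ?_ ?_⟩
      · filter_upwards [hev] with R hR using EReal.coe_le_coe_iff.2 (abs_le.1 hR).1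
      · isBoundedDefault
      · filter_upwards [hev] with R hR using EReal.coe_le_coe_iff.2 (abs_le.1 hR).2
  refine ⟨M * (1 / lam), fun g => ⟨le_sInf ?_, ?_⟩⟩
  · rintro _ ⟨v, U, hv, hU, rfl⟩
    exact (hcost hv hU.continuousOn).1
  · exact (valueFunction_le (isControl_const hV0) (isTrajectory_const X g)).trans
      (hcost (isControl_const hV0) continuousOn_const).2

theorem valueFunction_zero_nonneg (hV : IsCompact V)
    (hℓ : ContinuousOn (fun p : G × (Fin m → ℝ) => ℓ p.1 p.2) (univ ×ˢ V)) {c : ℝ} (hc0 : 0 < c)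
    (hc : ∀ g, ∀ u ∈ V, c ≤ ℓ g u) (g : G) : 0 ≤ valueFunction X V T ℓ 0 g := by
  refine le_sInf ?_
  rintro _ ⟨v, U, hv, hU, rfl⟩
  have hint := intervalIntegrable_runningCost hV hℓ 0 hv hU.continuousOn
  by_cases h : (hitTimes (frontier T) U).Nonempty
  · obtain ⟨τ, hτ⟩ := exists_isLeast_hitTimes isClosed_frontier hU.continuousOn h
    rw [cost_of_isLeast hτ]
    have h1 := mul_le_runningCost_zero hτ.1.1 (hint 0 τ le_rfl hτ.1.1)
      fun s hs => hc _ _ (hv.mem s hs)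
    exact_mod_cast (mul_nonneg hc0.le hτ.1.1).trans h1
  · rw [cost_zero_eq_top hc0 hint (fun s hs => hc _ _ (hv.mem s hs)) h]
    exact le_top

variable [LieGroup (𝓡 d) ∞ G] [IsTopologicalGroup G]

/-- The points which can be reached from the identity. -/
def reachableSubmonoid (X : Fin m → GroupLieAlgebra (𝓡 d) G) (hV0 : (0 : Fin m → ℝ) ∈ V) :
    Submonoid G where
  carrier := {s | ∃ v U t, IsControl V v ∧ IsTrajectory X v 1 U ∧ 0 ≤ t ∧ U t = s}
  one_mem' := ⟨_, _, 0, isControl_const hV0, isTrajectory_const X 1, le_rfl, rfl⟩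
  mul_mem' := by
    rintro _ _ ⟨v, U, t, hv, hU, ht, rfl⟩ ⟨w, W, r, hw, hW, hr, rfl⟩
    -- The right factor `W r` is reached first; the trajectory `U` is then run from there,
    -- translated by `W r`.
    have hU' : IsTrajectory X v (W r) fun s => U s * W r := by simpa using hU.mul_right (W r)
    refine ⟨_, _, r + t, hw.concat hv r, hW.concat hr hU', add_nonneg hr ht, ?_⟩
    rw [concat_of_ge _ _ (le_add_of_nonneg_right ht), add_sub_cancel_left]

/-- The four `ε` pay for the near-optimal control at `g`, the change of running cost, the gap of `S`
at the stopping time, and the near-optimal continuation from `U t * h`. -/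
theorem valueFunction_mul_right_le {S : G → ℝ} (hV : IsCompact V) (hV0 : (0 : Fin m → ℝ) ∈ V)
    (hℓ : ContinuousOn (fun p : G × (Fin m → ℝ) => ℓ p.1 p.2) (univ ×ˢ V)) (hlam : 0 ≤ lam)
    (hS : ∀ g, valueFunction X V T ℓ lam g = (S g : EReal)) {ε η K : ℝ} {h : G} (hε : 0 < ε)
    (hη0 : 0 ≤ η) (hη : ∀ g, ∀ u ∈ V, |ℓ (g * h) u - ℓ g u| ≤ η) (hηK : η * K ≤ ε)
    (hC : ∀ c ∈ frontier T, S (c * h) ≤ ε ∧ -ε ≤ S (c * h⁻¹))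
    (hK : ∀ g v U, IsControl V v → IsTrajectory X v g U →
      cost (frontier T) ℓ lam v U < ((S g + ε : ℝ) : EReal) → ∀ t, 0 ≤ t →
      (∀ s, 0 ≤ s → s < t → U s ∉ frontier T) → ∫ s in (0 : ℝ)..t, Real.exp (-lam * s) ≤ K)
    (g : G) : S (g * h) ≤ S g + 4 * ε := by
  obtain ⟨v, U, hv, hU, hcost⟩ : ∃ v U, IsControl V v ∧ IsTrajectory X v g U ∧
      cost (frontier T) ℓ lam v U < ((S g + ε : ℝ) : EReal) :=
    exists_cost_lt (by rw [hS]; exact_mod_cast lt_add_of_pos_right _ hε)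
  have hU' := hU.mul_right h
  have hS0 : ∀ c ∈ frontier T, S c = 0 := fun c hc => by
    have := (hS c).symm.trans (valueFunction_eq_zero hV0 hc)
    exact_mod_cast this
  have hint := intervalIntegrable_runningCost hV hℓ lam hv hU.continuousOn
  have hint' := intervalIntegrable_runningCost hV hℓ lam hv hU'.continuousOn
  have hrun {t : ℝ} (ht : 0 ≤ t) (hno : ∀ s, 0 ≤ s → s < t → U s ∉ frontier T) :
      runningCost ℓ lam v (fun t => U t * h) t ≤ runningCost ℓ lam v U t + ε := by
    have h1 := abs_runningCost_sub_le ht (hint 0 t le_rfl ht) (hint' 0 t le_rfl ht)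
      fun s hs => hη (U s) (v s) (hv.mem s hs)
    have h2 := mul_le_mul_of_nonneg_left (hK g v U hv hU hcost t ht hno) hη0
    linarith [(abs_le.1 h1).2]
  -- Hitting this union means that `U` or `U * h` meets the boundary; before that time dynamic
  -- programming applies to both.
  by_cases hhit : (hitTimes (frontier T ∪ (fun x => x * h) ⁻¹' frontier T) U).Nonempty
  · obtain ⟨t, ⟨ht, htC⟩, hmin⟩ := exists_isLeast_hitTimes
      (isClosed_frontier.union (isClosed_frontier.preimage (by fun_prop))) hU.continuousOn hhit
    have hno (s : ℝ) (hs : 0 ≤ s) (hst : s < t) : U s ∉ frontier T := fun hmem =>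
      (hmin ⟨hs, Or.inl hmem⟩).not_gt hst
    have hno' (s : ℝ) (hs : 0 ≤ s) (hst : s < t) : U s * h ∉ frontier T := fun hmem =>
      (hmin ⟨hs, Or.inr hmem⟩).not_gt hst
    have hlow := (runningCost_add_valueFunction_le_cost hV hℓ hv hU ht hno).trans_lt hcost
    rw [hS] at hlow
    have hlow' : runningCost ℓ lam v U t + Real.exp (-lam * t) * S (U t) < S g + ε := by
      exact_mod_cast hlow
    have hup : S (g * h) ≤ runningCost ℓ lam v (fun t => U t * h) t +
        Real.exp (-lam * t) * (S (U t * h) + ε) := by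
      obtain ⟨w, W, hw, hW, hwW⟩ : ∃ w W, IsControl V w ∧ IsTrajectory X w (U t * h) W ∧
          cost (frontier T) ℓ lam w W < ((S (U t * h) + ε : ℝ) : EReal) :=
        exists_cost_lt (by rw [hS]; exact_mod_cast lt_add_of_pos_right _ hε)
      have h1 := valueFunction_le_runningCost_add_cost (lam := lam) hV hℓ hv hU' ht hno' hw hW
      have h0 : (0 : EReal) ≤ (Real.exp (-lam * t) : ℝ) := by exact_mod_cast (Real.exp_pos _).le
      have h2 := h1.trans (add_le_add_right (mul_le_mul_of_nonneg_left hwW.le h0) _)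
      rw [hS] at h2
      exact_mod_cast h2
    have he0 := Real.exp_pos (-lam * t)
    have he1 : Real.exp (-lam * t) ≤ 1 := Real.exp_le_one_iff.2 (by nlinarith)
    have hr := hrun ht hno
    -- One of the two points lies on the boundary, where `S = 0`; if it is `U t * h`, then `U t` is
    -- its translate by `h⁻¹`.
    have hdiff : S (U t * h) - S (U t) ≤ ε := by
      rcases htC with hc | hc
      · linarith [hS0 _ hc, (hC _ hc).1]
      · have := (hC _ hc).2
        rw [mul_inv_cancel_right] at this
        linarith [hS0 _ hc]
    nlinarith
  -- Neither trajectory ever hits, so the running cost comparison passes to the `limsup`.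
  · have h1 : ¬ (hitTimes (frontier T) U).Nonempty := fun ⟨t, ht⟩ => hhit ⟨t, ht.1, Or.inl ht.2⟩
    have h2 : ¬ (hitTimes (frontier T) fun t => U t * h).Nonempty := fun ⟨t, ht⟩ =>
      hhit ⟨t, ht.1, Or.inr ht.2⟩
    have h3 := limsup_coe_affine (f := runningCost ℓ lam v U) ε one_pos
    rw [EReal.coe_one, one_mul, ← cost_of_not_nonempty h1] at h3
    have h4 : cost (frontier T) ℓ lam v (fun t => U t * h) ≤
        (ε : EReal) + cost (frontier T) ℓ lam v U := by
      rw [← h3, cost_of_not_nonempty h2]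
      refine limsup_le_limsup ?_
      filter_upwards [eventually_ge_atTop (0 : ℝ)] with R hR
      have := hrun hR fun s hs _ hmem => h1 ⟨s, hs, hmem⟩
      exact_mod_cast (by linarith)
    have h5 := (valueFunction_le hv hU').trans (h4.trans (add_le_add_right hcost.le _))
    rw [hS] at h5
    have h6 : S (g * h) ≤ ε + (S g + ε) := by exact_mod_cast h5
    linarith

theorem continuous_of_valueFunction_eq {S : G → ℝ} (hV : IsCompact V)
    (hV0 : (0 : Fin m → ℝ) ∈ V)
    (hℓ : ContinuousOn (fun p : G × (Fin m → ℝ) => ℓ p.1 p.2) (univ ×ˢ V)) (hlam : 0 ≤ lam)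
    (hS : ∀ g, valueFunction X V T ℓ lam g = (S g : EReal))
    (hcont : ∀ c ∈ frontier T, ContinuousAt S c) {K : ℝ} (hK0 : 0 < K)
    (hK : ∀ g v U, IsControl V v → IsTrajectory X v g U →
      cost (frontier T) ℓ lam v U < ((S g + 1 : ℝ) : EReal) → ∀ t, 0 ≤ t →
      (∀ s, 0 ≤ s → s < t → U s ∉ frontier T) → ∫ s in (0 : ℝ)..t, Real.exp (-lam * s) ≤ K) :
    Continuous S := by
  have hS0 : ∀ c ∈ frontier T, S c = 0 := fun c hc => by
    have := (hS c).symm.trans (valueFunction_eq_zero hV0 hc)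
    exact_mod_cast this
  have key (ε : ℝ) (hε : 0 < ε) (hε1 : ε ≤ 1) :
      ∀ᶠ h in 𝓝 (1 : G), ∀ g, S (g * h) ≤ S g + 4 * ε := by
    have hη : 0 < ε / K := by positivity
    have hnear : ∀ᶠ h in 𝓝 (1 : G), ∀ c ∈ frontier T, |S (c * h)| < ε := by
      refine isClosed_frontier.isCompact.eventually_forall_of_forall_eventually fun c hc => ?_
      have h1 : ContinuousAt (fun p : G × G => |S (p.2 * p.1)|) (1, c) := by
        refine ContinuousAt.abs (ContinuousAt.comp (g := S) (f := fun p : G × G => p.2 * p.1) ?_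
          (by fun_prop))
        simpa using hcont c hc
      exact h1.eventually_lt continuousAt_const (by simpa [hS0 c hc] using hε)
    have hinv : Tendsto (fun h : G => h⁻¹) (𝓝 1) (𝓝 1) := by
      simpa using (continuous_inv (G := G)).tendsto 1
    filter_upwards [hnear, hinv.eventually hnear, eventually_abs_mul_right_sub_le hV hℓ hη]
      with h h1 h2 h3
    refine valueFunction_mul_right_le hV hV0 hℓ hlam hS hε hη.le h3
      (div_mul_cancel₀ _ hK0.ne').le
      (fun c hc => ⟨(abs_lt.1 (h1 c hc)).2.le, (abs_lt.1 (h2 c hc)).1.le⟩)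
      fun g v U hv hU hcost => hK g v U hv hU (hcost.trans_le ?_)
    exact_mod_cast add_le_add_right hε1 (S g)
  refine continuous_iff_continuousAt.2 fun g => Metric.tendsto_nhds.2 fun ε hε => ?_
  have hε' : 0 < min 1 (ε / 8) := by positivity
  have hk := key _ hε' (min_le_left _ _)
  -- The one-sided estimate is used twice, with `x = g * (g⁻¹ * x)` and `g = x * (x⁻¹ * g)`; its
  -- uniformity in the base point allows the second use.
  have h1 : Tendsto (fun x => g⁻¹ * x) (𝓝 g) (𝓝 1) := by
    simpa using (continuous_const_mul g⁻¹).tendsto g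
  have h2 : Tendsto (fun x => x⁻¹ * g) (𝓝 g) (𝓝 1) := by
    simpa using ((continuous_inv (G := G)).mul continuous_const).tendsto (f := fun x => x⁻¹ * g) g
  filter_upwards [h1.eventually hk, h2.eventually hk] with x hx hx'
  have a := hx g
  have b := hx' x
  rw [mul_inv_cancel_left] at a b
  rw [Real.dist_eq, abs_lt]
  constructor <;> linarith [min_le_right 1 (ε / 8)]

/-- A control steering `g` to where `S < 1` also works near `g`, by right translation, which bounds
`S` locally; compactness makes the bound global. -/
theorem valueFunction_zero_bddAbove [T2Space G] [ConnectedSpace G] (hV : IsCompact V)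
    (hV0 : (0 : Fin m → ℝ) ∈ V)
    (hℓ : ContinuousOn (fun p : G × (Fin m → ℝ) => ℓ p.1 p.2) (univ ×ˢ V)) {c : ℝ} (hc0 : 0 < c)
    (hc : ∀ g, ∀ u ∈ V, c ≤ ℓ g u) (hne : (frontier T).Nonempty) {N : Set G} (hN : IsOpen N)
    (hTN : frontier T ⊆ N) (hSN : ContinuousOn (valueFunction X V T ℓ 0) N) :
    ∃ B : ℝ, ∀ g, valueFunction X V T ℓ 0 g ≤ (B : ℝ) := by
  obtain ⟨M, hM0, hM⟩ := exists_abs_le_of_isCompact hV hℓ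
  have hO : IsOpen (N ∩ valueFunction X V T ℓ 0 ⁻¹' Iio 1) :=
    hSN.isOpen_inter_preimage hN isOpen_Iio
  have hTO : frontier T ⊆ N ∩ valueFunction X V T ℓ 0 ⁻¹' Iio 1 := fun x hx =>
    ⟨hTN hx, by
      rw [mem_preimage, valueFunction_eq_zero hV0 hx]
      exact zero_lt_one' EReal⟩
  -- `S < 1` yields a control of finite cost, and without discount only trajectories that hit the
  -- boundary have finite cost.
  have hhit : ∀ g ∈ N ∩ valueFunction X V T ℓ 0 ⁻¹' Iio 1,
      ∃ s ∈ reachableSubmonoid X hV0, s * g ∈ frontier T := by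
    rintro g ⟨-, hg⟩
    obtain ⟨v, U, hv, hU, hlt⟩ := exists_cost_lt hg
    have hint := intervalIntegrable_runningCost hV hℓ 0 hv hU.continuousOn
    have h : (hitTimes (frontier T) U).Nonempty := by
      by_contra h
      rw [cost_zero_eq_top hc0 hint (fun s hs => hc _ _ (hv.mem s hs)) h] at hlt
      exact not_top_lt hlt
    obtain ⟨t, ht, hmem⟩ := h
    refine ⟨U t * g⁻¹, ⟨v, fun s => U s * g⁻¹, t, hv, ?_, ht, rfl⟩, by simpa using hmem⟩
    simpa using hU.mul_right g⁻¹
  have hreach := exists_mul_mem_of_isOpen (reachableSubmonoid X hV0) hO isClosed_frontier hne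
    hTO hhit
  have hloc (g : G) : ∃ A ∈ 𝓝 g, ∃ B : ℝ, ∀ x ∈ A, valueFunction X V T ℓ 0 x ≤ (B : ℝ) := by
    obtain ⟨_, ⟨v, U, t, hv, hU, ht, rfl⟩, hg⟩ := hreach g
    refine ⟨_, (hO.preimage (continuous_const_mul (U t))).mem_nhds hg, M * t + 1, ?_⟩
    rintro x ⟨-, hx⟩
    have hUx : IsTrajectory X v x fun s => U s * x := by simpa using hU.mul_right x
    have hJ {r : ℝ} (hr : 0 ≤ r) (hrt : r ≤ t) :
        runningCost ℓ 0 v (fun s => U s * x) r ≤ M * t := by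
      have h1 := abs_runningCost_le (ℓ := ℓ) (lam := 0) (U := fun s => U s * x) hr
        fun s hs => hM _ _ (hv.mem s hs)
      have h2 : (∫ s in (0 : ℝ)..r, Real.exp (-0 * s)) = r := by simp
      rw [h2] at h1
      exact (le_abs_self _).trans (h1.trans (mul_le_mul_of_nonneg_left hrt hM0))
    by_cases hno : ∀ s, 0 ≤ s → s < t → U s * x ∉ frontier T
    · obtain ⟨w, W, hw, hW, hlt⟩ := exists_cost_lt hx
      have h1 := valueFunction_le_runningCost_add_cost (lam := 0) hV hℓ hv hUx ht hno hw hW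
      rw [neg_zero, zero_mul, Real.exp_zero, EReal.coe_one, one_mul] at h1
      refine h1.trans ?_
      rw [EReal.coe_add, EReal.coe_one]
      exact add_le_add (EReal.coe_le_coe_iff.2 (hJ ht le_rfl)) hlt.le
    -- If the boundary is met on the way, the cost stops there and is already at most `M * t`.
    · push Not at hno
      obtain ⟨s, hs, hst, hmem⟩ := hno
      obtain ⟨τ, hτ⟩ := exists_isLeast_hitTimes isClosed_frontier hUx.continuousOn ⟨s, hs, hmem⟩
      refine (valueFunction_le hv hUx).trans ?_
      rw [cost_of_isLeast hτ]
      have := hJ hτ.1.1 ((hτ.2 ⟨hs, hmem⟩).trans hst.le)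
      exact EReal.coe_le_coe_iff.2 (by linarith)
  obtain ⟨B, hB⟩ := isCompact_univ.induction_on
    (p := fun A : Set G => ∃ B : ℝ, ∀ x ∈ A, valueFunction X V T ℓ 0 x ≤ (B : ℝ))
    ⟨0, by simp⟩ (fun A A' hA ⟨B, hB⟩ => ⟨B, fun x hx => hB x (hA hx)⟩)
    (fun A A' ⟨B, hB⟩ ⟨B', hB'⟩ => ⟨max B B', fun x hx => hx.elim
      (fun h => (hB x h).trans (EReal.coe_le_coe_iff.2 (le_max_left _ _)))
      fun h => (hB' x h).trans (EReal.coe_le_coe_iff.2 (le_max_right _ _))⟩)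
    (fun x _ => by simpa using hloc x)
  exact ⟨B, fun g => hB g (mem_univ g)⟩

end ValueFunction

end LieControl

theorem mainTheorem6 {d m : ℕ} {G : Type*} [TopologicalSpace G]
    [ChartedSpace (EuclideanSpace ℝ (Fin d)) G] [Group G] [LieGroup (𝓡 d) ∞ G]
    [T2Space G] [CompactSpace G] [ConnectedSpace G]
    (X : Fin m → GroupLieAlgebra (𝓡 d) G)
    (hX : LieSubalgebra.lieSpan ℝ (GroupLieAlgebra (𝓡 d) G) (Set.range X) = ⊤)
    (V : Set (Fin m → ℝ)) (hV : IsCompact V) (hV0 : (0 : Fin m → ℝ) ∈ V)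
    (T : Set G) (hT : IsCompact T)
    (ℓ : G → (Fin m → ℝ) → ℝ) (lam : ℝ) (hlam : 0 ≤ lam)
    -- the undiscounted case: nonempty target boundary, running cost bounded below by some `c > 0`
    (hzero : lam = 0 →
      (frontier T).Nonempty ∧ ∃ c : ℝ, 0 < c ∧ ∀ g : G, ∀ u ∈ V, c ≤ ℓ g u)
    (hf : ContinuousOn (fun p : G × (Fin m → ℝ) =>
      (⟨p.1, LieControl.dynamics X p.1 p.2⟩ : TangentBundle (𝓡 d) G)) (Set.univ ×ˢ V))
    (hℓ : ContinuousOn (fun p : G × (Fin m → ℝ) => ℓ p.1 p.2) (Set.univ ×ˢ V))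
    (hS : ∃ N : Set G, IsOpen N ∧ frontier T ⊆ N ∧
      ContinuousOn (LieControl.valueFunction X V T ℓ lam) N) :
    ∃ S : G → ℝ, (∀ g, LieControl.valueFunction X V T ℓ lam g = (S g : EReal)) ∧
      (∃ B : ℝ, ∀ g, |S g| ≤ B) ∧ Continuous S := by
  have : IsTopologicalGroup G := topologicalGroup_of_lieGroup (𝓡 d) ∞
  obtain ⟨N, hN, hTN, hSN⟩ := hS
  have hcont {S : G → ℝ} (hSv : ∀ g, LieControl.valueFunction X V T ℓ lam g = (S g : EReal)) :
      ∀ c ∈ frontier T, ContinuousAt S c := fun c hc => by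
    have := hSN.continuousAt (hN.mem_nhds (hTN hc))
    rw [show LieControl.valueFunction X V T ℓ lam = fun g => (S g : EReal) from funext hSv] at this
    exact EReal.isEmbedding_coe.continuousAt_iff.2 this
  rcases hlam.eq_or_lt with rfl | hpos
  · obtain ⟨hne, c, hc0, hc⟩ := hzero rfl
    obtain ⟨B, hB⟩ := LieControl.valueFunction_zero_bddAbove hV hV0 hℓ hc0 hc hne hN hTN hSN
    have hnonneg := LieControl.valueFunction_zero_nonneg (X := X) (T := T) hV hℓ hc0 hc
    have hB0 : 0 ≤ B := EReal.coe_le_coe_iff.1 ((hnonneg 1).trans (hB 1))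
    obtain ⟨S, hSv, hSB⟩ := LieControl.exists_real_valueFunction (B := B) fun g =>
      ⟨(EReal.coe_le_coe_iff.2 (neg_nonpos.2 hB0)).trans (hnonneg g), hB g⟩
    refine ⟨S, hSv, ⟨B, hSB⟩, ?_⟩
    -- As `S ≥ 0`, a control within `1` of optimal satisfies `c * t ≤ S g + 1 ≤ B + 1` up to its
    -- hitting time, whence `K`.
    refine LieControl.continuous_of_valueFunction_eq hV hV0 hℓ le_rfl hSv (hcont hSv)
      (K := (B + 1) / c) (by positivity) fun g v U hv hU hcost t ht hno => ?_
    have h1 := (LieControl.runningCost_add_valueFunction_le_cost hV hℓ hv hU ht hno).trans_lt hcost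
    rw [hSv] at h1
    have h2 : LieControl.runningCost ℓ 0 v U t + Real.exp (-0 * t) * S (U t) < S g + 1 := by
      exact_mod_cast h1
    have h3 : 0 ≤ S (U t) := by
      have := hnonneg (U t)
      rw [hSv] at this
      exact_mod_cast this
    have h4 := LieControl.mul_le_runningCost_zero ht
      (LieControl.intervalIntegrable_runningCost hV hℓ 0 hv hU.continuousOn 0 t le_rfl ht)
      fun s hs => hc _ _ (hv.mem s hs)
    have h5 : (∫ s in (0 : ℝ)..t, Real.exp (-0 * s)) = t := by simp
    rw [h5, le_div_iff₀ hc0]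
    have h6 := mul_nonneg (Real.exp_pos (-0 * t)).le h3
    linarith [(abs_le.1 (hSB g)).2]
  · obtain ⟨B, hB⟩ := LieControl.abs_valueFunction_le_of_pos (X := X) (T := T) hV hV0 hℓ hpos
    obtain ⟨S, hSv, hSB⟩ := LieControl.exists_real_valueFunction hB
    exact ⟨S, hSv, ⟨B, hSB⟩, LieControl.continuous_of_valueFunction_eq hV hV0 hℓ hlam hSv
      (hcont hSv) (K := 1 / lam) (by positivity)
      fun g v U hv hU hcost t ht hno => LieControl.integral_exp_neg_mul_le hpos t⟩
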